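/- All graphs are finite, simple, undirected and connected. An $n$-vertex graph with $m$ edges is a tree, unicyclic, bicyclic, tricyclic or tetracyclic graph if $m=n-1$, $n$, $n+1$, $n+2$ or $n+3$, respectively. For $\alpha\in\mathbb{R}$, $\alpha\ge 1$, the general sum-connectivity index of a graph $G$ is $\chi_\alpha(G)=\sum_{uv\in E(G)}(d_u+d_v)^\alpha$, where $d_u$ is the degree of $u$. Let $S_n$ be the $n$-vertex star. For $n$ large enough, each of the following graphs is obtained from $S_n$ by adding edges between its pendent vertices $1,2,\dots,n-1$: $S_n^+$ (add $12$); $B_1$ (add $12,13$); $G_4$ (add $12,13,14$); $G_5$ (add $12,13,23$); $H_4$ (add $12,13,14,15$); $H_5$ (add $12,13,23,14$). Theorem. Let $\alpha\ge 1$. Up to isomorphism: (1) for $n\ge1$, the unique graph with maximum $\chi_\alpha$ among the $n$-vertex trees is $S_n$; for $n\ge3$, the unique one among the $n$-vertex unicyclic graphs is $S_n^+$; for $n\ge4$, the unique one among the $n$-vertex bicyclic graphs is $B_1$; (2) for $n\ge5$, the maximum of $\chi_\alpha$ among the $n$-vertex tricyclic graphs is attained by $G_4$ or by $G_5$. More precisely,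 if $1<\alpha<2$, then $\chi_\alpha(G_4)<\chi_\alpha(G_5)$ and $G_5$ is the unique maximiser; if $\alpha>2$, then $\chi_\alpha(G_4)>\chi_\alpha(G_5)$ and $G_4$ is the unique maximiser; if $\alpha\in\{1,2\}$, then $\chi_\alpha(G_4)=\chi_\alpha(G_5)$ and the maximisers are exactly $G_4$ and $G_5$; (3) among the $n$-vertex tetracyclic graphs, the unique graph with maximum $\chi_\alpha$ is $H_4$ if $n\ge6$, and $H_5$ if $n=5$. -/

import Mathlib

/-- The edge weight `(d_u + d_v) ^ α` as a function of the unordered pair `{u, v}`. -/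
noncomputable def edgeWeight {V : Type*} (d : V → ℕ) (α : ℝ) : Sym2 V → ℝ :=
  Sym2.lift ⟨fun u v => ((d u : ℝ) + (d v : ℝ)) ^ α, fun u v => by simp only [add_comm]⟩

open Classical in
/-- The general sum-connectivity index `χ_α(G) = ∑_{uv ∈ E(G)} (d_u + d_v) ^ α`. -/
noncomputable def generalSumConnectivity {V : Type*} [Fintype V] (α : ℝ)
    (G : SimpleGraph V) : ℝ :=
  ∑ e ∈ G.edgeFinset, edgeWeight (fun v => G.degree v) α e

open Classical in
/-- `G` is a connected graph on `n = |V|` vertices with `m = n - 1 + c` edges: a tree for `c = 0`,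
and a unicyclic, bicyclic, tricyclic, tetracyclic graph for `c = 1, 2, 3, 4`. -/
def IsCyclicGraph {V : Type*} [Fintype V] (c : ℕ) (G : SimpleGraph V) : Prop :=
  G.Connected ∧ G.edgeFinset.card + 1 = Fintype.card V + c

/-- `G` has the maximum value of `χ_α` among all connected graphs on the same vertex set with
`|V| - 1 + c` edges. -/
def IsChiMaximiser {V : Type*} [Fintype V] (α : ℝ) (c : ℕ) (G : SimpleGraph V) : Prop :=
  IsCyclicGraph c G ∧
    ∀ G' : SimpleGraph V, IsCyclicGraph c G' →
      generalSumConnectivity α G' ≤ generalSumConnectivity α G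

/-- The graph on `{0, …, n - 1}` obtained from the star with centre `0` by adding the edges
listed in `L` (pairs of vertices outside the range are ignored). -/
def starPlus (n : ℕ) (L : List (ℕ × ℕ)) : SimpleGraph (Fin n) :=
  SimpleGraph.fromRel fun i j => i.val = 0 ∨ (i.val, j.val) ∈ L

/-- The star `S_n`. -/
def graphS (n : ℕ) : SimpleGraph (Fin n) := starPlus n []

/-- `S_n⁺`: the star plus one edge. -/
def graphSPlus (n : ℕ) : SimpleGraph (Fin n) := starPlus n [(1, 2)]

/-- `B_1`: the star plus the edges of a path with three vertices on its pendent vertices. -/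
def graphB1 (n : ℕ) : SimpleGraph (Fin n) := starPlus n [(1, 2), (1, 3)]

/-- `G_4`: the star plus three edges joining one pendent vertex to three others. -/
def graphG4 (n : ℕ) : SimpleGraph (Fin n) := starPlus n [(1, 2), (1, 3), (1, 4)]

/-- `G_5`: the star plus the edges of a triangle on three of its pendent vertices. -/
def graphG5 (n : ℕ) : SimpleGraph (Fin n) := starPlus n [(1, 2), (1, 3), (2, 3)]

/-- `H_4`: the star plus four edges joining one pendent vertex to four others. -/
def graphH4 (n : ℕ) : SimpleGraph (Fin n) := starPlus n [(1, 2), (1, 3), (1, 4), (1, 5)]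

/-- `H_5`: the star plus the edges of a triangle on three of its pendent vertices, plus one edge
joining a vertex of that triangle to a fourth pendent vertex. -/
def graphH5 (n : ℕ) : SimpleGraph (Fin n) := starPlus n [(1, 2), (1, 3), (2, 3), (1, 4)]

/-! The engine is the Kelmans transformation: for two vertices `u`, `v` that are adjacent or share a
neighbour, the private neighbours of `v` are handed over to `u`. This preserves connectivity, the
number of edges and all degrees other than those of `u` and `v`. The degrees of `u` and `v` keep
their sum but are pushed apart. By convexity and monotonicity of `t ^ α` for `α ≥ 1`, the index
strictly increases as soon as each of `u`, `v` has a private neighbour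
(`generalSumConnectivity_lt_kelmansShift`).

Hence in a maximiser the neighbourhoods of vertices at distance at most two are nested. A vertex of
maximum degree must then dominate the graph, so all pairs are at distance at most two and all
neighbourhoods are nested. Removing the dominating vertex leaves exactly `c` edges, again nested, so
they form a star plus edges among its leaves. Iterating this peeling for `c ≤ 4` leaves one shape
for `c ≤ 2` and at most two for `c = 3, 4` (`IsNestedGraph.classify`).

For `c ≤ 2`, existence of a maximiser by finiteness finishes the proof. For `c = 3` the two
candidates differ by a third difference of `t ^ α` at `n`, whose sign is that of `α - 2` for `α >
1`. For `c = 4` and `n ≥ 6` the inequality `rpow_tetracyclic_pos` decides. For `n = 5` there is no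
room for the fourth leaf's vertex in `graphH4`. -/

section

open Finset
open scoped Classical

/-! ### The index as a double sum over vertices, and isomorphism invariance. -/

section ChiFormula
variable {V W : Type*} [Fintype V] [Fintype W]

/-- The sum of a symmetric function over ordered pairs of adjacent vertices is twice its sum over
the edges. -/
lemma sum_adj_eq_two_mul_sum_edges (G : SimpleGraph V) (f : Sym2 V → ℝ) :
    ∑ u, ∑ v, (if G.Adj u v then f s(u, v) else 0) = 2 * ∑ e ∈ G.edgeFinset, f e := by
  rw [← Finset.sum_product', univ_product_univ, ← Finset.sum_filter, Finset.mul_sum]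
  have hmap : ∀ p ∈ (univ : Finset (V × V)).filter (fun p => G.Adj p.1 p.2),
      s(p.1, p.2) ∈ G.edgeFinset := by
    intro p hp
    simpa using hp
  rw [← Finset.sum_fiberwise_of_maps_to hmap]
  refine Finset.sum_congr rfl fun e he => ?_
  induction e with | _ a b
  have hab : G.Adj a b := by simpa using he
  -- The fibre over an edge consists of its two orientations.
  have hset : ((univ : Finset (V × V)).filter (fun p => G.Adj p.1 p.2)).filter
      (fun p => s(p.1, p.2) = s(a, b)) = {(a, b), (b, a)} := by
    ext ⟨x, y⟩
    simp only [mem_filter, mem_univ, true_and, Sym2.eq_iff, mem_insert, mem_singleton, Prod.mk.injEq]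
    constructor
    · rintro ⟨_, h⟩; exact h
    · rintro (⟨rfl, rfl⟩ | ⟨rfl, rfl⟩)
      · exact ⟨hab, Or.inl ⟨rfl, rfl⟩⟩
      · exact ⟨hab.symm, Or.inr ⟨rfl, rfl⟩⟩
  rw [hset, Finset.sum_pair (by simp [hab.ne]), two_mul, Sym2.eq_swap (a := b)]

/-- The degree of a vertex as a sum of indicators. -/
lemma degree_eq_sum (G : SimpleGraph V) (u : V) :
    G.degree u = ∑ v, if G.Adj u v then 1 else 0 := by
  rw [← Finset.card_filter, ← SimpleGraph.card_neighborFinset_eq_degree]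
  congr 1
  ext v
  simp

lemma two_mul_generalSumConnectivity (α : ℝ) (G : SimpleGraph V) :
    2 * generalSumConnectivity α G =
      ∑ u, ∑ v, if G.Adj u v then ((G.degree u : ℝ) + (G.degree v : ℝ)) ^ α else 0 := by
  unfold generalSumConnectivity
  rw [← sum_adj_eq_two_mul_sum_edges]
  rfl

lemma isCyclicGraph_iff (c : ℕ) (G : SimpleGraph V) :
    IsCyclicGraph c G ↔
      G.Connected ∧ ∑ u, G.degree u + 2 = 2 * Fintype.card V + 2 * c := by
  unfold IsCyclicGraph
  rw [SimpleGraph.sum_degrees_eq_twice_card_edges]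
  constructor
  · rintro ⟨h, h'⟩; exact ⟨h, by omega⟩
  · rintro ⟨h, h'⟩; exact ⟨h, by omega⟩

lemma generalSumConnectivity_congr (α : ℝ) {G : SimpleGraph V} {H : SimpleGraph W} (e : G ≃g H) :
    generalSumConnectivity α G = generalSumConnectivity α H := by
  have h : 2 * generalSumConnectivity α G = 2 * generalSumConnectivity α H := by
    rw [two_mul_generalSumConnectivity, two_mul_generalSumConnectivity]
    rw [← Equiv.sum_comp e.toEquiv]
    refine Finset.sum_congr rfl fun u _ => ?_
    rw [← Equiv.sum_comp e.toEquiv]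
    refine Finset.sum_congr rfl fun v _ => ?_
    have hd : ∀ w, H.degree (e.toEquiv w) = G.degree w := fun w => e.degree_eq w
    have ha : H.Adj (e.toEquiv u) (e.toEquiv v) ↔ G.Adj u v := e.map_adj_iff
    simp only [hd, ha]
  linarith

lemma IsCyclicGraph.congr {c : ℕ} {G : SimpleGraph V} {H : SimpleGraph W} (e : G ≃g H)
    (h : IsCyclicGraph c G) : IsCyclicGraph c H := by
  rw [isCyclicGraph_iff] at h ⊢
  refine ⟨(e.connected_iff).1 h.1, ?_⟩
  have hs : ∑ u, H.degree u = ∑ u, G.degree u := by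
    rw [← Equiv.sum_comp e.toEquiv]
    exact Finset.sum_congr rfl fun w _ => e.degree_eq w
  rw [hs, h.2, Fintype.card_congr e.toEquiv]

end ChiFormula

/-! ### The Kelmans transformation and its effect on the index. -/

section Kelmans
variable {V : Type*}

/-- The Kelmans transformation: the neighbours of `v` that are not neighbours of `u` are moved
from `v` to `u`. -/
def kelmansShift (G : SimpleGraph V) (u v : V) : SimpleGraph V where
  Adj a b := a ≠ b ∧
    if a = u then (if b = v then G.Adj u v else G.Adj u b ∨ G.Adj v b)
    else if a = v then (if b = u then G.Adj u v else G.Adj u b ∧ G.Adj v b)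
    else if b = u then G.Adj u a ∨ G.Adj v a
    else if b = v then G.Adj u a ∧ G.Adj v a
    else G.Adj a b
  symm := ⟨by
    intro a b ⟨h, h'⟩
    refine ⟨h.symm, ?_⟩
    by_cases h1 : a = u <;> by_cases h2 : a = v <;> by_cases h3 : b = u <;> by_cases h4 : b = v <;>
      simp_all [SimpleGraph.adj_comm]⟩
  loopless := ⟨fun a h => h.1 rfl⟩

variable {G : SimpleGraph V} {u v : V}

lemma kelmansShift_adj_pair (huv : u ≠ v) : (kelmansShift G u v).Adj u v ↔ G.Adj u v := by
  simp [kelmansShift, huv]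

lemma kelmansShift_adj_left {w : V} (hu : w ≠ u) (hv : w ≠ v) :
    (kelmansShift G u v).Adj u w ↔ G.Adj u w ∨ G.Adj v w := by
  simp [kelmansShift, hu.symm, hv]

lemma kelmansShift_adj_right (huv : u ≠ v) {w : V} (hu : w ≠ u) (hv : w ≠ v) :
    (kelmansShift G u v).Adj v w ↔ G.Adj u w ∧ G.Adj v w := by
  simp [kelmansShift, hu, hv.symm, huv.symm]

lemma kelmansShift_adj_of_ne {a b : V} (hau : a ≠ u) (hav : a ≠ v) (hbu : b ≠ u) (hbv : b ≠ v) :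
    (kelmansShift G u v).Adj a b ↔ G.Adj a b := by
  simp only [kelmansShift, hau, hav, hbu, hbv, if_false]
  exact ⟨fun h => h.2, fun h => ⟨h.ne, h⟩⟩

/-- An edge `uv` is kept and a common neighbour stays common, so `u` and `v` remain connected. Any
edge lost at `v` reappears at `u`, so the ends of every old edge are still reachable from each
other. -/
lemma kelmansShift_connected (hG : G.Connected) (huv : u ≠ v)
    (h : G.Adj u v ∨ ∃ c, G.Adj u c ∧ G.Adj v c) : (kelmansShift G u v).Connected := by
  set K := kelmansShift G u v with hK
  have hruv : K.Reachable u v := by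
    rcases h with h | ⟨c, hu, hv⟩
    · exact ((kelmansShift_adj_pair huv).2 h).reachable
    · have h1 : K.Adj u c := (kelmansShift_adj_left hu.ne' hv.ne').2 (Or.inl hu)
      have h2 : K.Adj v c := (kelmansShift_adj_right huv hu.ne' hv.ne').2 ⟨hu, hv⟩
      exact h1.reachable.trans h2.reachable.symm
  have hu : ∀ w, G.Adj u w → K.Reachable u w := by
    intro w hw
    by_cases hv : w = v
    · rw [hv]; exact hruv
    · exact ((kelmansShift_adj_left hw.ne' hv).2 (Or.inl hw)).reachable
  have hv : ∀ w, G.Adj v w → K.Reachable v w := by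
    intro w hw
    by_cases hu : w = u
    · rw [hu]; exact hruv.symm
    · exact hruv.symm.trans ((kelmansShift_adj_left hu hw.ne').2 (Or.inr hw)).reachable
  have hadj : ∀ a b, G.Adj a b → K.Reachable a b := by
    intro a b hab
    by_cases h1 : a = u
    · subst h1; exact hu b hab
    by_cases h2 : a = v
    · subst h2; exact hv b hab
    by_cases h3 : b = u
    · subst h3; exact (hu a hab.symm).symm
    by_cases h4 : b = v
    · subst h4; exact (hv a hab.symm).symm
    exact ((kelmansShift_adj_of_ne h1 h2 h3 h4).2 hab).reachable
  have hwalk : ∀ a b, G.Walk a b → K.Reachable a b := by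
    intro a b p
    induction p with
    | nil => exact SimpleGraph.Reachable.refl _
    | cons h _ ih => exact (hadj _ _ h).trans ih
  have := hG.nonempty
  refine SimpleGraph.Connected.mk fun a b => ?_
  obtain ⟨p⟩ := hG.preconnected a b
  exact hwalk a b p

variable [Fintype V]

/-- Splitting a sum over all vertices at two distinct vertices. -/
lemma sum_split_pair {M : Type*} [AddCommMonoid M] (huv : u ≠ v) (f : V → M) :
    ∑ w, f w = f u + (f v + ∑ w ∈ ((univ.erase u).erase v), f w) := by
  rw [Finset.add_sum_erase _ _ (by simp [huv.symm]), Finset.add_sum_erase _ _ (mem_univ _)]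

lemma degree_left_split (huv : u ≠ v) :
    G.degree u = (if G.Adj u v then 1 else 0) +
      ∑ w ∈ (univ.erase u).erase v, if G.Adj u w then 1 else 0 := by
  rw [degree_eq_sum, sum_split_pair huv]; simp

lemma degree_right_split (huv : u ≠ v) :
    G.degree v = (if G.Adj u v then 1 else 0) +
      ∑ w ∈ (univ.erase u).erase v, if G.Adj v w then 1 else 0 := by
  rw [degree_eq_sum, sum_split_pair huv]; simp [SimpleGraph.adj_comm]

/-- At most an edge `vw` is exchanged for `uw`, which `w` does not notice. -/
lemma kelmansShift_degree_of_ne (huv : u ≠ v) {w : V} (hu : w ≠ u) (hv : w ≠ v) :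
    (kelmansShift G u v).degree w = G.degree w := by
  rw [degree_eq_sum, degree_eq_sum, sum_split_pair huv, sum_split_pair huv]
  rw [SimpleGraph.adj_comm _ w u, SimpleGraph.adj_comm _ w v, kelmansShift_adj_left hu hv,
    kelmansShift_adj_right huv hu hv, SimpleGraph.adj_comm _ w u, SimpleGraph.adj_comm _ w v,
    ← add_assoc, ← add_assoc]
  congr 1
  · by_cases h1 : G.Adj u w <;> by_cases h2 : G.Adj v w <;> simp [h1, h2]
  · refine Finset.sum_congr rfl fun x hx => ?_
    simp only [mem_erase, mem_univ, and_true] at hx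
    simp only [kelmansShift_adj_of_ne hu hv hx.2 hx.1]

lemma kelmansShift_degree_add (huv : u ≠ v) :
    (kelmansShift G u v).degree u + (kelmansShift G u v).degree v = G.degree u + G.degree v := by
  rw [degree_left_split huv, degree_right_split huv, degree_left_split (G := G) huv,
    degree_right_split (G := G) huv, kelmansShift_adj_pair huv]
  have : ∑ w ∈ (univ.erase u).erase v, (if (kelmansShift G u v).Adj u w then 1 else 0) +
      ∑ w ∈ (univ.erase u).erase v, (if (kelmansShift G u v).Adj v w then 1 else 0) =
      ∑ w ∈ (univ.erase u).erase v, (if G.Adj u w then 1 else 0) +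
      ∑ w ∈ (univ.erase u).erase v, (if G.Adj v w then 1 else 0) := by
    rw [← Finset.sum_add_distrib, ← Finset.sum_add_distrib]
    refine Finset.sum_congr rfl fun w hw => ?_
    simp only [mem_erase, mem_univ, and_true] at hw
    simp only [kelmansShift_adj_left hw.2 hw.1, kelmansShift_adj_right huv hw.2 hw.1]
    by_cases h1 : G.Adj u w <;> by_cases h2 : G.Adj v w <;> simp [h1, h2]
  omega

/-- The new neighbourhood of `u` contains the old one and gains the private neighbour `y` of `v`.
The next lemma is the mirror image: compared with the old neighbourhood of `v`, the surplus is the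
private neighbour `x` of `u`. -/
lemma degree_left_lt_kelmansShift (huv : u ≠ v) {y : V} (hyu : y ≠ u) (hy : G.Adj v y)
    (hy' : ¬ G.Adj u y) : G.degree u < (kelmansShift G u v).degree u := by
  rw [degree_left_split (G := G) huv, degree_left_split (G := kelmansShift G u v) huv,
    kelmansShift_adj_pair huv]
  refine Nat.add_lt_add_left (Finset.sum_lt_sum (fun w hw => ?_) ⟨y, ?_, ?_⟩) _
  · simp only [mem_erase, mem_univ, and_true] at hw
    simp only [kelmansShift_adj_left hw.2 hw.1]
    by_cases h1 : G.Adj u w <;> simp [h1]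
  · simp [hyu, hy.ne']
  · simp [kelmansShift_adj_left hyu hy.ne', hy, hy']

lemma degree_right_lt_kelmansShift (huv : u ≠ v) {x : V} (hxv : x ≠ v) (hx : G.Adj u x)
    (hx' : ¬ G.Adj v x) : G.degree v < (kelmansShift G u v).degree u := by
  rw [degree_right_split (G := G) huv, degree_left_split (G := kelmansShift G u v) huv,
    kelmansShift_adj_pair huv]
  refine Nat.add_lt_add_left (Finset.sum_lt_sum (fun w hw => ?_) ⟨x, ?_, ?_⟩) _
  · simp only [mem_erase, mem_univ, and_true] at hw
    simp only [kelmansShift_adj_left hw.2 hw.1]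
    by_cases h1 : G.Adj v w <;> simp [h1]
  · simp [hxv, hx.ne']
  · simp [kelmansShift_adj_left hx.ne' hxv, hx, hx']

lemma kelmansShift_isCyclicGraph {c : ℕ} (hG : IsCyclicGraph c G) (huv : u ≠ v)
    (h : G.Adj u v ∨ ∃ c, G.Adj u c ∧ G.Adj v c) : IsCyclicGraph c (kelmansShift G u v) := by
  rw [isCyclicGraph_iff] at hG ⊢
  refine ⟨kelmansShift_connected hG.1 huv h, ?_⟩
  rw [← hG.2, sum_split_pair huv, sum_split_pair huv, ← add_assoc, ← add_assoc,
    kelmansShift_degree_add huv]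
  congr 2
  refine Finset.sum_congr rfl fun w hw => ?_
  simp only [mem_erase, mem_univ, and_true] at hw
  exact kelmansShift_degree_of_ne huv hw.2 hw.1

/-- A double sum of a symmetric function with zero diagonal, split at two distinct vertices. -/
lemma double_sum_split_pair (huv : u ≠ v) (f : V → V → ℝ) (hf : ∀ a b, f a b = f b a)
    (hd : ∀ a, f a a = 0) :
    ∑ a, ∑ b, f a b = 2 * f u v + 2 * ∑ w ∈ (univ.erase u).erase v, (f u w + f v w) +
      ∑ a ∈ (univ.erase u).erase v, ∑ b ∈ (univ.erase u).erase v, f a b := by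
  have h1 : ∀ s : Finset V, ∑ w ∈ s, f w u = ∑ w ∈ s, f u w :=
    fun s => Finset.sum_congr rfl fun w _ => hf _ _
  have h2 : ∀ s : Finset V, ∑ w ∈ s, f w v = ∑ w ∈ s, f v w :=
    fun s => Finset.sum_congr rfl fun w _ => hf _ _
  rw [sum_split_pair huv]
  simp only [sum_split_pair huv (f _), Finset.sum_add_distrib, hd, h1, h2]
  rw [hf v u]
  ring

/-- Karamata's inequality for two terms: `a` and `b` lie in `[b', a']` with the same sum as the
endpoints, so both values lie below the chord of a convex function, and the two chord values add up
to the values at the endpoints. -/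
lemma rpow_add_rpow_le_of_spread {α a b a' b' : ℝ} (hα : 1 ≤ α) (hb' : 0 ≤ b') (hsum : a' + b' = a + b)
    (ha : a ≤ a') (hb : b ≤ a') : a ^ α + b ^ α ≤ a' ^ α + b' ^ α := by
  -- If the interval degenerates the chord weights would divide by zero, but then both pairs
  -- coincide.
  rcases eq_or_lt_of_le (show b' ≤ a' by linarith) with h | h
  · have e1 : a = a' := by linarith
    have e2 : b = b' := by linarith
    rw [e1, e2]
  have hc := (convexOn_rpow hα).2
  have hpos : 0 < a' - b' := by linarith
  have key : ∀ t : ℝ, b' ≤ t → t ≤ a' →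
      t ^ α ≤ (t - b') / (a' - b') * a' ^ α + (a' - t) / (a' - b') * b' ^ α := by
    intro t ht1 ht2
    have := hc (x := a') (by simp; linarith) (y := b') (by simpa using hb')
      (a := (t - b') / (a' - b')) (b := (a' - t) / (a' - b'))
      (div_nonneg (by linarith) hpos.le) (div_nonneg (by linarith) hpos.le)
      (by rw [← add_div]; rw [div_eq_one_iff_eq hpos.ne']; ring)
    simp only [smul_eq_mul] at this
    have ht : (t - b') / (a' - b') * a' + (a' - t) / (a' - b') * b' = t := by
      field_simp
      ring
    rwa [ht] at this
  have k1 := key a (by linarith) ha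
  have k2 := key b (by linarith) hb
  have e : (a - b') / (a' - b') * a' ^ α + (a' - a) / (a' - b') * b' ^ α +
      ((b - b') / (a' - b') * a' ^ α + (a' - b) / (a' - b') * b' ^ α) = a' ^ α + b' ^ α := by
    have : b = a' + b' - a := by linarith
    subst this
    field_simp
    ring
  linarith

/-- The edge `uv` and the edges avoiding both vertices keep their weights. A common neighbour
contributes a pair of weights that is spread apart, and a private neighbour an edge whose end at `u`
or `v` is replaced by the larger new degree of `u`. The neighbour `x` makes the gain strict. -/
lemma generalSumConnectivity_lt_kelmansShift {α : ℝ} (hα : 1 ≤ α) (huv : u ≠ v) {x y : V}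
    (hxv : x ≠ v) (hx : G.Adj u x) (hx' : ¬ G.Adj v x)
    (hyu : y ≠ u) (hy : G.Adj v y) (hy' : ¬ G.Adj u y) :
    generalSumConnectivity α G < generalSumConnectivity α (kelmansShift G u v) := by
  set K := kelmansShift G u v with hK
  have hα0 : 0 < α := by linarith
  have hadd : (K.degree u : ℝ) + K.degree v = G.degree u + G.degree v := by
    exact_mod_cast kelmansShift_degree_add huv
  have hlu : (G.degree u : ℝ) < K.degree u := by
    exact_mod_cast degree_left_lt_kelmansShift huv hyu hy hy'
  have hlv : (G.degree v : ℝ) < K.degree u := by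
    exact_mod_cast degree_right_lt_kelmansShift huv hxv hx hx'
  have hdeg : ∀ w ∈ (univ.erase u).erase v, K.degree w = G.degree w := by
    intro w hw
    simp only [mem_erase, mem_univ, and_true] at hw
    exact kelmansShift_degree_of_ne huv hw.2 hw.1
  suffices h : 2 * generalSumConnectivity α G < 2 * generalSumConnectivity α K by linarith
  rw [two_mul_generalSumConnectivity, two_mul_generalSumConnectivity]
  rw [double_sum_split_pair huv _ (fun a b => by simp only [G.adj_comm a b, add_comm]) (by simp),
    double_sum_split_pair huv _ (fun a b => by simp only [K.adj_comm a b, add_comm]) (by simp)]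
  have e1 : ∑ a ∈ (univ.erase u).erase v, ∑ b ∈ (univ.erase u).erase v,
        (if K.Adj a b then ((K.degree a : ℝ) + K.degree b) ^ α else 0) =
      ∑ a ∈ (univ.erase u).erase v, ∑ b ∈ (univ.erase u).erase v,
        (if G.Adj a b then ((G.degree a : ℝ) + G.degree b) ^ α else 0) := by
    refine Finset.sum_congr rfl fun a ha => Finset.sum_congr rfl fun b hb => ?_
    rw [hdeg a ha, hdeg b hb]
    simp only [mem_erase, mem_univ, and_true] at ha hb
    simp only [hK, kelmansShift_adj_of_ne ha.2 ha.1 hb.2 hb.1]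
  rw [e1]
  have e2 : (K.Adj u v) ↔ G.Adj u v := kelmansShift_adj_pair huv
  simp only [e2, hadd]
  have e3 : ∑ w ∈ (univ.erase u).erase v,
      ((if G.Adj u w then ((G.degree u : ℝ) + G.degree w) ^ α else 0) +
        (if G.Adj v w then ((G.degree v : ℝ) + G.degree w) ^ α else 0)) <
      ∑ w ∈ (univ.erase u).erase v,
      ((if K.Adj u w then ((K.degree u : ℝ) + K.degree w) ^ α else 0) +
        (if K.Adj v w then ((K.degree v : ℝ) + K.degree w) ^ α else 0)) := by
    refine Finset.sum_lt_sum (fun w hw => ?_) ⟨x, by simp [hxv, hx.ne'], ?_⟩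
    · rw [hdeg w hw]
      simp only [mem_erase, mem_univ, and_true] at hw
      have a1 : K.Adj u w ↔ _ := kelmansShift_adj_left hw.2 hw.1
      have a2 : K.Adj v w ↔ _ := kelmansShift_adj_right huv hw.2 hw.1
      simp only [a1, a2]
      by_cases h1 : G.Adj u w <;> by_cases h2 : G.Adj v w <;> simp only [h1, h2, if_true, if_false,
        or_true, or_false, and_true, and_false, le_refl, add_zero, zero_add]
      · exact rpow_add_rpow_le_of_spread hα (by positivity) (by linarith) (by linarith) (by linarith)
      · exact Real.rpow_le_rpow (by positivity) (by linarith) hα0.le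
      · exact Real.rpow_le_rpow (by positivity) (by linarith) hα0.le
    · rw [hdeg x (by simp [hxv, hx.ne'])]
      have a1 : K.Adj u x ↔ _ := kelmansShift_adj_left hx.ne' hxv
      have a2 : K.Adj v x ↔ _ := kelmansShift_adj_right huv hx.ne' hxv
      simp only [a1, a2, hx, hx', if_true, if_false, or_false, and_false, add_zero]
      exact Real.rpow_lt_rpow (by positivity) (by linarith) hα0
  linarith

/-- In a maximiser, the neighbourhoods of two vertices at distance at most two are nested, up to
the two vertices themselves. -/
lemma IsChiMaximiser.nested {α : ℝ} (hα : 1 ≤ α) {c : ℕ} (hG : IsChiMaximiser α c G) (huv : u ≠ v)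
    (h : G.Adj u v ∨ ∃ c, G.Adj u c ∧ G.Adj v c) :
    (∀ x, x ≠ v → G.Adj u x → G.Adj v x) ∨ (∀ y, y ≠ u → G.Adj v y → G.Adj u y) := by
  by_contra! hcon
  obtain ⟨⟨x, hxv, hx, hx'⟩, ⟨y, hyu, hy, hy'⟩⟩ := hcon
  exact absurd (hG.2 _ (kelmansShift_isCyclicGraph hG.1 huv h))
    (not_le.2 (generalSumConnectivity_lt_kelmansShift hα huv hxv hx hx' hyu hy hy'))

end Kelmans

/-! ### Nested neighbourhoods: stars, dominating vertices and peeling. -/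

section Structure
variable {V : Type*}

/-- Every two neighbourhoods are nested, up to the two vertices themselves. -/
def IsNestedGraph (G : SimpleGraph V) : Prop :=
  ∀ u v, u ≠ v → (∀ x, x ≠ v → G.Adj u x → G.Adj v x) ∨ (∀ y, y ≠ u → G.Adj v y → G.Adj u y)

/-- The number of ordered pairs of adjacent vertices inside `S`. -/
noncomputable def adjCount (G : SimpleGraph V) (S : Finset V) : ℕ :=
  ∑ u ∈ S, (S.filter (G.Adj u)).card

variable {G : SimpleGraph V}

lemma adjCount_eq_zero_iff {S : Finset V} :
    adjCount G S = 0 ↔ ∀ a ∈ S, ∀ b ∈ S, ¬ G.Adj a b := by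
  unfold adjCount
  rw [Finset.sum_eq_zero_iff]
  refine forall₂_congr fun a _ => ?_
  rw [Finset.card_eq_zero, Finset.filter_eq_empty_iff]

lemma adjCount_le (S : Finset V) : adjCount G S ≤ S.card * (S.card - 1) := by
  refine (Finset.sum_le_card_nsmul _ _ (S.card - 1) fun u hu => ?_).trans_eq (smul_eq_mul _ _)
  rw [← Finset.card_erase_of_mem hu]
  refine Finset.card_le_card fun w hw => ?_
  rw [Finset.mem_filter] at hw
  exact Finset.mem_erase.2 ⟨hw.2.ne', hw.1⟩

/-- Removing a vertex `x` whose neighbours in `S` contain all other non-isolated vertices. -/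
lemma adjCount_eq_of_star {S T : Finset V} {x : V} (hx : x ∈ S) (hTS : T ⊆ S)
    (hadj : ∀ w ∈ S, G.Adj x w ↔ w ∈ T)
    (hin : ∀ a ∈ S, ∀ b ∈ S, G.Adj a b → a = x ∨ a ∈ T) :
    adjCount G S = 2 * T.card + adjCount G T := by
  have hxT : x ∉ T := fun h => G.loopless.irrefl x ((hadj x hx).2 h)
  have hTe : T ⊆ S.erase x := fun w hw =>
    Finset.mem_erase.2 ⟨fun h => hxT (h ▸ hw), hTS hw⟩
  have h1 : S.filter (G.Adj x) = T := by
    ext w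
    rw [Finset.mem_filter]
    exact ⟨fun h => (hadj w h.1).1 h.2, fun h => ⟨hTS h, (hadj w (hTS h)).2 h⟩⟩
  have h2 : ∀ u ∈ S.erase x, u ∉ T → (S.filter (G.Adj u)).card = 0 := by
    intro u hu hT
    rw [Finset.mem_erase] at hu
    rw [Finset.card_eq_zero, Finset.filter_eq_empty_iff]
    intro b hb hab
    rcases hin u hu.2 b hb hab with h | h
    · exact hu.1 h
    · exact hT h
  have h3 : ∀ u ∈ T, (S.filter (G.Adj u)).card = 1 + (T.filter (G.Adj u)).card := by
    intro u hu
    have : S.filter (G.Adj u) = insert x (T.filter (G.Adj u)) := by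
      ext b
      simp only [Finset.mem_filter, Finset.mem_insert]
      constructor
      · rintro ⟨hb, hab⟩
        rcases hin b hb u (hTS hu) hab.symm with h | h
        · exact Or.inl h
        · exact Or.inr ⟨h, hab⟩
      · rintro (rfl | ⟨hb, hab⟩)
        · exact ⟨hx, ((hadj u (hTS hu)).2 hu).symm⟩
        · exact ⟨hTS hb, hab⟩
    rw [this, Finset.card_insert_of_notMem (by simp [hxT]), add_comm]
  unfold adjCount
  rw [← Finset.add_sum_erase _ _ hx, h1, ← Finset.sum_subset hTe h2, Finset.sum_congr rfl h3,
    Finset.sum_add_distrib]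
  simp
  ring

/-- In a nested graph the edges inside `S` form a star together with edges between its leaves. -/
lemma IsNestedGraph.exists_star (hG : IsNestedGraph G) {S : Finset V} (hS : adjCount G S ≠ 0) :
    ∃ x ∈ S, ∃ T ⊆ S, x ∉ T ∧
      (∀ a ∈ S, ∀ b ∈ S,
        G.Adj a b ↔ (a = x ∧ b ∈ T) ∨ (b = x ∧ a ∈ T) ∨ (a ∈ T ∧ b ∈ T ∧ G.Adj a b)) ∧
      adjCount G S = 2 * T.card + adjCount G T := by
  have hne : S.Nonempty := by
    rw [Finset.nonempty_iff_ne_empty]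
    rintro rfl
    exact hS (by simp [adjCount])
  obtain ⟨x, hx, hmax⟩ := S.exists_max_image (fun u => (S.filter (G.Adj u)).card) hne
  -- The centre `x` has maximum degree inside `S`; exhibiting a larger neighbourhood in `S` is a
  -- contradiction.
  have hlt : ∀ a ∈ S, ∀ s : Finset V, s ⊆ S.filter (G.Adj a) →
      (S.filter (G.Adj x)).card < s.card → False := by
    intro a ha s hs hcard
    have := Finset.card_le_card hs
    have := hmax a ha
    omega
  -- Otherwise `a` is a neighbour of `b` but not of `x`, so nesting goes the other way and `b` sees
  -- `a`, `x` and all neighbours of `x` but itself: one more than `x` has.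
  have hb : ∀ a ∈ S, ∀ b ∈ S, G.Adj a b → G.Adj x b → a = x ∨ G.Adj x a := by
    intro a ha b hb hab hxb
    by_contra! hcon
    have hn : ∀ y, y ≠ b → G.Adj x y → G.Adj b y := by
      rcases hG b x hxb.ne' with h | h
      · exact absurd (h a hcon.1 hab.symm) hcon.2
      · exact h
    refine hlt b hb (insert a (insert x ((S.filter (G.Adj x)).erase b))) ?_ ?_
    · intro w hw
      simp only [Finset.mem_insert, Finset.mem_erase, Finset.mem_filter] at hw ⊢
      rcases hw with rfl | rfl | ⟨h1, h2, h3⟩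
      · exact ⟨ha, hab.symm⟩
      · exact ⟨hx, hxb.symm⟩
      · exact ⟨h2, hn w h1 h3⟩
    · have hm : b ∈ S.filter (G.Adj x) := Finset.mem_filter.2 ⟨hb, hxb⟩
      rw [Finset.card_insert_of_notMem (by simp [hcon]), Finset.card_insert_of_notMem (by simp),
        Finset.card_erase_of_mem hm]
      have := Finset.card_pos.2 ⟨b, hm⟩
      omega
  -- An edge `ab` with both ends away from `x` and its neighbours would make `a` see `b` on top of
  -- all neighbours of `x`, again too many.
  have hin : ∀ a ∈ S, ∀ b ∈ S, G.Adj a b → a = x ∨ G.Adj x a := by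
    intro a ha b hbS hab
    by_cases hxb : G.Adj x b
    · exact hb a ha b hbS hab hxb
    by_contra! hcon
    have hbx : b ≠ x := by
      rintro rfl
      exact hcon.2 hab.symm
    have hn : ∀ y, y ≠ a → G.Adj x y → G.Adj a y := by
      rcases hG a x hcon.1 with h | h
      · exact absurd (h b hbx hab) hxb
      · exact h
    refine hlt a ha (insert b (S.filter (G.Adj x))) ?_ ?_
    · intro w hw
      simp only [Finset.mem_insert, Finset.mem_filter] at hw ⊢
      rcases hw with rfl | ⟨h2, h3⟩
      · exact ⟨hbS, hab⟩
      · exact ⟨h2, hn w (fun h => hcon.2 (h ▸ h3)) h3⟩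
    · rw [Finset.card_insert_of_notMem (by simp [hxb])]
      omega
  refine ⟨x, hx, S.filter (G.Adj x), Finset.filter_subset _ _, by simp, ?_, ?_⟩
  · intro a ha b hbS
    simp only [Finset.mem_filter]
    constructor
    · intro hab
      rcases hin a ha b hbS hab with rfl | h1
      · exact Or.inl ⟨rfl, hbS, hab⟩
      · rcases hin b hbS a ha hab.symm with rfl | h2
        · exact Or.inr (Or.inl ⟨rfl, ha, hab.symm⟩)
        · exact Or.inr (Or.inr ⟨⟨ha, h1⟩, ⟨hbS, h2⟩, hab⟩)
    · rintro (⟨rfl, _, h⟩ | ⟨rfl, _, h⟩ | ⟨_, _, h⟩)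
      · exact h
      · exact h.symm
      · exact h
  · refine adjCount_eq_of_star hx (Finset.filter_subset _ _) (by intro w hw; simp [hw]) ?_
    intro a ha b hbS hab
    rcases hin a ha b hbS hab with h | h
    · exact Or.inl h
    · exact Or.inr (by simp [ha, h])

variable [Fintype V]

/-- A vertex of maximum degree of a maximiser is adjacent to all other vertices. -/
lemma IsChiMaximiser.exists_dominating {α : ℝ} (hα : 1 ≤ α) {c : ℕ} (hG : IsChiMaximiser α c G) :
    ∃ z, ∀ w, w ≠ z → G.Adj z w := by
  have hconn := hG.1.1
  have := hconn.nonempty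
  obtain ⟨z, -, hmax⟩ := (univ : Finset V).exists_max_image (fun u => G.degree u) univ_nonempty
  refine ⟨z, ?_⟩
  -- A vertex `w` at distance two through `x` would force the degree of `x` above the maximum degree
  -- of `z`. Here nesting is needed only for the adjacent pair `z`, `x`; walks then propagate
  -- domination to the whole connected graph.
  have key : ∀ x w, G.Adj z x → G.Adj x w → w = z ∨ G.Adj z w := by
    intro x w hzx hxw
    by_contra! hcon
    have hn : ∀ y, y ≠ x → G.Adj z y → G.Adj x y := by
      rcases hG.nested hα hzx.ne (Or.inl hzx) with h | h
      · exact h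
      · exact absurd (h w hcon.1 hxw) hcon.2
    have hsub : insert w (insert z ((G.neighborFinset z).erase x)) ⊆ G.neighborFinset x := by
      intro y hy
      simp only [Finset.mem_insert, Finset.mem_erase, SimpleGraph.mem_neighborFinset] at hy ⊢
      rcases hy with rfl | rfl | ⟨h1, h2⟩
      · exact hxw
      · exact hzx.symm
      · exact hn y h1 h2
    have hm : x ∈ G.neighborFinset z := by simpa using hzx
    have h1 := Finset.card_le_card hsub
    rw [Finset.card_insert_of_notMem (by simp [hcon]), Finset.card_insert_of_notMem (by simp),
      Finset.card_erase_of_mem hm] at h1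
    have h2 := Finset.card_pos.2 ⟨x, hm⟩
    have h3 := hmax x (mem_univ _)
    simp only [SimpleGraph.card_neighborFinset_eq_degree] at h1 h2
    omega
  have hwalk : ∀ a b, G.Walk a b → (a = z ∨ G.Adj z a) → (b = z ∨ G.Adj z b) := by
    intro a b p
    induction p with
    | nil => exact id
    | cons h _ ih =>
      intro ha
      refine ih ?_
      rcases ha with rfl | ha
      · exact Or.inr h
      · exact key _ _ ha h
  intro w hw
  obtain ⟨p⟩ := hconn.preconnected z w
  exact (hwalk z w p (Or.inl rfl)).resolve_left hw

/-- Through the dominating vertex any two vertices are at distance at most two, so the distance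
condition in `IsChiMaximiser.nested` is automatic. -/
lemma IsChiMaximiser.isNestedGraph {α : ℝ} (hα : 1 ≤ α) {c : ℕ} (hG : IsChiMaximiser α c G) :
    IsNestedGraph G := by
  obtain ⟨z, hz⟩ := hG.exists_dominating hα
  intro u v huv
  refine hG.nested hα huv ?_
  by_cases hu : u = z
  · subst hu; exact Or.inl (hz v huv.symm)
  by_cases hv : v = z
  · subst hv; exact Or.inl (hz u hu).symm
  exact Or.inr ⟨z, (hz u hu).symm, (hz v hv).symm⟩

lemma adjCount_univ : adjCount G univ = ∑ u, G.degree u := by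
  unfold adjCount
  refine Finset.sum_congr rfl fun u _ => ?_
  rw [← SimpleGraph.card_neighborFinset_eq_degree, SimpleGraph.neighborFinset_eq_filter]

/-- Of the `n - 1 + c` edges, `n - 1` meet `z`; the remaining `c` are each counted in both
orientations. -/
lemma adjCount_erase_dominating {c : ℕ} (hG : IsCyclicGraph c G) {z : V}
    (hz : ∀ w, w ≠ z → G.Adj z w) : adjCount G (univ.erase z) = 2 * c := by
  rw [isCyclicGraph_iff] at hG
  have h := adjCount_eq_of_star (G := G) (S := univ) (T := univ.erase z) (mem_univ z)
    (Finset.erase_subset _ _)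
    (by
      intro w _
      simp only [mem_erase, mem_univ, and_true]
      exact ⟨fun h => h.ne', hz w⟩)
    (by
      intro a _ b _ _
      simp only [mem_erase, mem_univ, and_true]
      exact em _)
  rw [adjCount_univ, Finset.card_erase_of_mem (mem_univ z), Finset.card_univ] at h
  have : 0 < Fintype.card V := Fintype.card_pos_iff.2 ⟨z⟩
  omega

/-! ### Identifying the nested graphs with the named graphs. -/

/-- A graph that has a dominating vertex, the head of `l`, and whose other edges join vertices of
`l` as prescribed by `L` is isomorphic to `starPlus n L`. -/
lemma nonempty_iso_starPlus {n : ℕ} (hn : Fintype.card V = n) (L : List (ℕ × ℕ)) (z : V)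
    (l : List V) (hl : (z :: l).Nodup)
    (hL : ∀ q ∈ L, q.1 < (z :: l).length ∧ q.2 < (z :: l).length)
    (hadj : ∀ a b, G.Adj a b ↔ a ≠ b ∧ (a = z ∨ b = z ∨ ∃ q ∈ L,
      ((z :: l)[q.1]? = some a ∧ (z :: l)[q.2]? = some b) ∨
      ((z :: l)[q.1]? = some b ∧ (z :: l)[q.2]? = some a))) :
    Nonempty (G ≃g starPlus n L) := by
  have hlen : (z :: l).length ≤ n := hn ▸ hl.length_le_card
  -- The required labelling is prescribed only on the list; a permutation of `Fin n` extends it to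
  -- all vertices, and the rest may be labelled arbitrarily.
  obtain ⟨σ, hσ⟩ := Equiv.Perm.exists_extending_pair
    (fun i : Fin (z :: l).length => Fintype.equivFinOfCardEq hn ((z :: l).get i))
    (fun i => Fin.castLE hlen i)
    ((Fintype.equivFinOfCardEq hn).injective.comp (List.nodup_iff_injective_get.1 hl))
    (Fin.castLE_injective hlen)
  set e : V ≃ Fin n := (Fintype.equivFinOfCardEq hn).trans σ with he
  have hval : ∀ (i : ℕ) (h : i < (z :: l).length), (e ((z :: l)[i])).val = i := by
    intro i h
    have := hσ ⟨i, h⟩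
    have h' := congrArg Fin.val this
    simpa [he] using h'
  have hget : ∀ (i : ℕ) (h : i < (z :: l).length) (a : V),
      (z :: l)[i]? = some a ↔ (e a).val = i := by
    intro i h a
    rw [List.getElem?_eq_getElem h, Option.some_inj]
    constructor
    · rintro rfl; exact hval i h
    · intro ha
      apply e.injective
      apply Fin.ext
      rw [hval i h, ha]
  have hzero : ∀ a, a = z ↔ (e a).val = 0 := by
    intro a
    rw [← hget 0 (by simp) a]
    simp [eq_comm]
  have hmem : ∀ a b, (∃ q ∈ L, ((z :: l)[q.1]? = some a ∧ (z :: l)[q.2]? = some b)) ↔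
      ((e a).val, (e b).val) ∈ L := by
    intro a b
    constructor
    · rintro ⟨⟨i, j⟩, hq, h1, h2⟩
      rw [(hget _ (hL _ hq).1 _)] at h1
      rw [(hget _ (hL _ hq).2 _)] at h2
      simpa [h1, h2] using hq
    · intro h
      exact ⟨_, h, (hget _ (hL _ h).1 _).2 rfl, (hget _ (hL _ h).2 _).2 rfl⟩
  refine ⟨⟨e, ?_⟩⟩
  intro a b
  rw [hadj]
  simp only [starPlus, SimpleGraph.fromRel_adj, ← hmem, and_or_left, exists_or, ← hzero,
    e.injective.ne_iff]
  generalize (∃ q ∈ L, (z :: l)[q.1]? = some a ∧ (z :: l)[q.2]? = some b) = P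
  generalize (∃ q ∈ L, (z :: l)[q.1]? = some b ∧ (z :: l)[q.2]? = some a) = Q
  tauto

/-- The graphs with nested neighbourhoods, a dominating vertex and at most four further edges. -/
lemma IsNestedGraph.classify (hG : IsNestedGraph G) {n : ℕ} (hn : Fintype.card V = n) {z : V}
    (hz : ∀ w, w ≠ z → G.Adj z w) {c : ℕ} (hc : adjCount G (univ.erase z) = 2 * c) :
    (c = 0 → Nonempty (G ≃g graphS n)) ∧ (c = 1 → Nonempty (G ≃g graphSPlus n)) ∧
    (c = 2 → Nonempty (G ≃g graphB1 n)) ∧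
    (c = 3 → Nonempty (G ≃g graphG4 n) ∨ Nonempty (G ≃g graphG5 n)) ∧
    (c = 4 → (Nonempty (G ≃g graphH4 n) ∧ 6 ≤ n) ∨ Nonempty (G ≃g graphH5 n)) := by
  have hadj0 : ∀ a b, G.Adj a b ↔
      a ≠ b ∧ (a = z ∨ b = z ∨ (a ≠ z ∧ b ≠ z ∧ G.Adj a b)) := by
    intro a b
    constructor
    · intro h
      refine ⟨h.ne, ?_⟩
      tauto
    · rintro ⟨h, rfl | rfl | h'⟩
      · exact hz b h.symm
      · exact (hz a h).symm
      · exact h'.2.2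
  rcases Nat.eq_zero_or_pos c with rfl | hpos
  · refine ⟨fun _ => ?_, by omega, by omega, by omega, by omega⟩
    rw [adjCount_eq_zero_iff] at hc
    refine nonempty_iso_starPlus hn [] z [] (by simp) (by simp) fun a b => ?_
    rw [hadj0]
    have := hc a
    simp only [mem_erase, mem_univ, and_true] at this
    have h2 : ¬ (a ≠ z ∧ b ≠ z ∧ G.Adj a b) := fun h => this h.1 b h.2.1 h.2.2
    simp only [h2]
    simp
  obtain ⟨x, hx, T, hT, hxT, hadj1, hcount⟩ := hG.exists_star (S := univ.erase z) (by omega)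
  have hle := adjCount_le (G := G) T
  have hxz : x ≠ z := (Finset.mem_erase.1 hx).1
  have hzT : z ∉ T := fun h => (Finset.mem_erase.1 (hT h)).1 rfl
  have hcardT : T.card + 2 ≤ n := by
    have := Finset.card_le_card (Finset.subset_univ (insert z (insert x T)))
    rwa [Finset.card_insert_of_notMem (by simp [hxz.symm, hzT]), Finset.card_insert_of_notMem hxT,
      Finset.card_univ, hn] at this
  have hadj2 : ∀ a b, G.Adj a b ↔ a ≠ b ∧ (a = z ∨ b = z ∨
      ((a = x ∧ b ∈ T) ∨ (b = x ∧ a ∈ T) ∨ (a ∈ T ∧ b ∈ T ∧ G.Adj a b))) := by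
    intro a b
    refine (hadj0 a b).trans (and_congr_right fun _ => ?_)
    by_cases ha : a = z
    · simp [ha]
    by_cases hb : b = z
    · simp [hb]
    simp only [ha, hb, false_or, ne_eq, not_false_iff, true_and]
    exact hadj1 a (by simp [ha]) b (by simp [hb])
  rw [hc] at hcount
  -- Either the `c` edges form a bare star with centre `x`, or some of them join leaves and the
  -- peeling is applied once more inside `T`.
  by_cases hT0 : adjCount G T = 0
  · have hTc : T.card = c := by omega
    rw [adjCount_eq_zero_iff] at hT0
    have hadj3 : ∀ a b, G.Adj a b ↔ a ≠ b ∧ (a = z ∨ b = z ∨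
        ((a = x ∧ b ∈ T) ∨ (b = x ∧ a ∈ T))) := by
      intro a b
      rw [hadj2]
      have h2 : ¬ (a ∈ T ∧ b ∈ T ∧ G.Adj a b) := fun h => hT0 a h.1 b h.2.1 h.2.2
      simp only [h2, or_false]
    refine ⟨by omega, fun h => ?_, fun h => ?_, fun h => Or.inl ?_, fun h => Or.inl ⟨?_, by omega⟩⟩
    · rw [h, Finset.card_eq_one] at hTc
      obtain ⟨y, rfl⟩ := hTc
      refine nonempty_iso_starPlus hn _ z [x, y] ?_ (by simp) fun a b => ?_
      · simp at hxT hzT ⊢; tauto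
      · rw [hadj3]; simp; grind
    · rw [h, Finset.card_eq_two] at hTc
      obtain ⟨y₁, y₂, h12, rfl⟩ := hTc
      refine nonempty_iso_starPlus hn _ z [x, y₁, y₂] ?_ (by simp) fun a b => ?_
      · simp at hxT hzT ⊢; tauto
      · rw [hadj3]; simp; grind
    · rw [h, Finset.card_eq_three] at hTc
      obtain ⟨y₁, y₂, y₃, h12, h13, h23, rfl⟩ := hTc
      refine nonempty_iso_starPlus hn _ z [x, y₁, y₂, y₃] ?_ (by simp) fun a b => ?_
      · simp at hxT hzT ⊢; tauto
      · rw [hadj3]; simp; grind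
    · obtain ⟨y₄, T', hy, rfl, hT'⟩ := Finset.card_eq_succ.1 (hTc.trans h)
      rw [Finset.card_eq_three] at hT'
      obtain ⟨y₁, y₂, y₃, h12, h13, h23, rfl⟩ := hT'
      refine nonempty_iso_starPlus hn _ z [x, y₁, y₂, y₃, y₄] ?_ (by simp) fun a b => ?_
      · simp at hxT hzT hy ⊢; grind
      · rw [hadj3]; simp; grind
  · obtain ⟨y, hy, T', hT', hyT', hadj4, hcount'⟩ := hG.exists_star hT0
    have hT'pos : 0 < T'.card := by
      rw [Nat.pos_iff_ne_zero]
      intro h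
      have := adjCount_le (G := G) T'
      rw [h] at this hcount'
      omega
    -- Doubled counts give `c ≥ |T| + |T'|` with `T'` nonempty, so `|T| < c`.
    have hy3 : c ≤ 4 → T.card ≤ 3 := by omega
    -- Conversely `2c ≤ |T| (|T| + 1)`, since `T` spans at most a complete graph. Both bounds
    -- together leave `|T| = c - 1`, hence a single edge `yw` inside `T`.
    have hTlow : c ≤ 4 → c ≠ 0 ∧ c ≠ 1 ∧ c ≠ 2 ∧ (c = 3 → T.card = 2) ∧ (c = 4 → T.card = 3) := by
      intro h4
      have := hy3 h4
      interval_cases hh : T.card <;> simp at hle <;> omega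
    have hfin : c ≤ 4 → ∃ w ∈ T, w ≠ y ∧ ∀ a b, G.Adj a b ↔ a ≠ b ∧ (a = z ∨ b = z ∨
        ((a = x ∧ b ∈ T) ∨ (b = x ∧ a ∈ T) ∨ (a = y ∧ b = w) ∨ (a = w ∧ b = y))) := by
      intro h4
      have h5 : T'.card = 1 := by
        have := hTlow h4
        omega
      have h6 : adjCount G T' = 0 := by
        have := adjCount_le (G := G) T'
        rw [h5] at this
        omega
      rw [Finset.card_eq_one] at h5
      obtain ⟨w, rfl⟩ := h5
      rw [adjCount_eq_zero_iff] at h6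
      have hwT : w ∈ T := hT' (by simp)
      have hwy : w ≠ y := by
        rintro rfl
        simp at hyT'
      refine ⟨w, hwT, hwy, fun a b => ?_⟩
      rw [hadj2]
      have h7 : (a ∈ T ∧ b ∈ T ∧ G.Adj a b) ↔ (a = y ∧ b = w) ∨ (a = w ∧ b = y) := by
        constructor
        · rintro ⟨ha, hb, hab⟩
          rw [hadj4 a ha b hb] at hab
          simp only [mem_singleton] at hab
          rcases hab with h | h | ⟨rfl, rfl, h⟩
          · exact Or.inl h
          · exact Or.inr h.symm
          · exact absurd h (G.loopless.irrefl _)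
        · rintro (⟨rfl, rfl⟩ | ⟨rfl, rfl⟩)
          · exact ⟨hy, hwT, (hadj4 _ hy _ hwT).2 (by simp)⟩
          · exact ⟨hwT, hy, (hadj4 _ hwT _ hy).2 (by simp)⟩
      rw [h7]
    refine ⟨fun h => absurd h (hTlow (by omega)).1, fun h => absurd h (hTlow (by omega)).2.1,
      fun h => absurd h (hTlow (by omega)).2.2.1, fun h => Or.inr ?_, fun h => Or.inr ?_⟩
    · obtain ⟨w, hw, hwy, hadj5⟩ := hfin (by omega)
      have hTe : {y, w} = T := Finset.eq_of_subset_of_card_le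
        (by intro t; simp; rintro (rfl | rfl) <;> assumption)
        (by rw [(hTlow (by omega)).2.2.2.1 h, Finset.card_pair hwy.symm])
      refine nonempty_iso_starPlus hn _ z [x, y, w] ?_ (by simp) fun a b => ?_
      · subst hTe; simp at hxT hzT ⊢; grind
      · rw [hadj5, ← hTe]; simp; grind
    · obtain ⟨w, hw, hwy, hadj5⟩ := hfin (by omega)
      have hTc : ((T.erase y).erase w).card = 1 := by
        rw [Finset.card_erase_of_mem (by simp [hw, hwy]), Finset.card_erase_of_mem hy,
          (hTlow (by omega)).2.2.2.2 h]
      rw [Finset.card_eq_one] at hTc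
      obtain ⟨t, ht⟩ := hTc
      have ht' : t ∈ (T.erase y).erase w := by simp [ht]
      simp only [mem_erase] at ht'
      have hTe : ∀ a, a ∈ T ↔ a = y ∨ a = w ∨ a = t := by
        intro a
        have := congrArg (a ∈ ·) ht
        simp only [mem_erase, mem_singleton, eq_iff_iff] at this
        grind
      rw [hTe] at hxT hzT
      refine nonempty_iso_starPlus hn _ z [x, y, w, t] ?_ (by simp) fun a b => ?_
      · simp; grind
      · rw [hadj5]; simp only [hTe]; simp; grind

end Structure

/-! ### Degrees, edge counts and closed formulas for the named graphs. -/

section StarPlus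

/-- Adjacency in `starPlus n L` in terms of natural numbers. -/
def StarAdj (L : List (ℕ × ℕ)) (i j : ℕ) : Prop :=
  i ≠ j ∧ (i = 0 ∨ (i, j) ∈ L ∨ j = 0 ∨ (j, i) ∈ L)

lemma starPlus_adj {n : ℕ} {L : List (ℕ × ℕ)} (i j : Fin n) :
    (starPlus n L).Adj i j ↔ StarAdj L i.val j.val := by
  simp only [starPlus, SimpleGraph.fromRel_adj, StarAdj, or_assoc, ne_eq, Fin.ext_iff]

/-- The degree of the vertex `i` of `starPlus n L`. -/
noncomputable def starDegree (n : ℕ) (L : List (ℕ × ℕ)) (i : ℕ) : ℕ :=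
  ∑ j ∈ range n, if StarAdj L i j then 1 else 0

lemma starPlus_degree {n : ℕ} {L : List (ℕ × ℕ)} (i : Fin n) :
    (starPlus n L).degree i = starDegree n L i.val := by
  rw [degree_eq_sum, starDegree,
    ← Fin.sum_univ_eq_sum_range (fun j => if StarAdj L i.val j then 1 else 0)]
  simp only [starPlus_adj]

lemma two_mul_generalSumConnectivity_starPlus (α : ℝ) (n : ℕ) (L : List (ℕ × ℕ)) :
    2 * generalSumConnectivity α (starPlus n L) = ∑ i ∈ range n, ∑ j ∈ range n,
      if StarAdj L i j then ((starDegree n L i : ℝ) + starDegree n L j) ^ α else 0 := by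
  rw [two_mul_generalSumConnectivity, ← Fin.sum_univ_eq_sum_range (fun i => ∑ j ∈ range n,
      if StarAdj L i j then ((starDegree n L i : ℝ) + starDegree n L j) ^ α else 0)]
  refine Finset.sum_congr rfl fun i _ => ?_
  rw [← Fin.sum_univ_eq_sum_range (fun j =>
      if StarAdj L i j then ((starDegree n L i : ℝ) + starDegree n L j) ^ α else 0)]
  simp only [starPlus_adj, starPlus_degree]

lemma starPlus_connected {n : ℕ} (hn : 0 < n) (L : List (ℕ × ℕ)) : (starPlus n L).Connected := by
  have : Nonempty (Fin n) := ⟨⟨0, hn⟩⟩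
  have h : ∀ a, (starPlus n L).Reachable ⟨0, hn⟩ a := by
    intro a
    by_cases ha : a = ⟨0, hn⟩
    · rw [ha]
    · refine SimpleGraph.Adj.reachable ?_
      rw [starPlus_adj]
      exact ⟨fun h => ha (Fin.ext h.symm), Or.inl rfl⟩
  exact SimpleGraph.Connected.mk fun a b => (h a).symm.trans (h b)

lemma starPlus_isCyclicGraph {n : ℕ} (hn : 0 < n) (L : List (ℕ × ℕ)) {c : ℕ}
    (h : ∑ i ∈ range n, starDegree n L i + 2 = 2 * n + 2 * c) :
    IsCyclicGraph c (starPlus n L) := by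
  rw [isCyclicGraph_iff]
  refine ⟨starPlus_connected hn L, ?_⟩
  simp only [starPlus_degree]
  rw [Fin.sum_univ_eq_sum_range (starDegree n L), h, Fintype.card_fin]

/-- The pairs in `L` consist of vertices smaller than `m`. -/
def PairsBelow (L : List (ℕ × ℕ)) (m : ℕ) : Prop :=
  0 < m ∧ ∀ q ∈ L, q.1 < m ∧ q.2 < m

variable {L : List (ℕ × ℕ)} {m : ℕ}

lemma starAdj_comm (i j : ℕ) : StarAdj L i j ↔ StarAdj L j i := by
  unfold StarAdj
  tauto

/-- Labels from `m` on do not occur in `L`, so these vertices are pendent. This reduces all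
computations for variable `n = m + k` to a fixed head of `m` vertices. -/
lemma PairsBelow.starAdj_tail (h : PairsBelow L m) (i x : ℕ) :
    StarAdj L i (m + x) ↔ i = 0 := by
  have hm := h.1
  unfold StarAdj
  constructor
  · rintro ⟨_, h1 | h1 | h1 | h1⟩
    · exact h1
    · have := (h.2 _ h1).2
      simp at this
    · omega
    · have := (h.2 _ h1).1
      simp at this
  · rintro rfl
    exact ⟨by omega, Or.inl rfl⟩

lemma PairsBelow.starDegree_head (h : PairsBelow L m) (k i : ℕ) :
    starDegree (m + k) L i = starDegree m L i + if i = 0 then k else 0 := by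
  unfold starDegree
  rw [Finset.sum_range_add]
  simp only [h.starAdj_tail]
  congr 1
  by_cases hi : i = 0 <;> simp [hi]

lemma PairsBelow.starDegree_tail (h : PairsBelow L m) (k x : ℕ) :
    starDegree (m + k) L (m + x) = 1 := by
  have hm := h.1
  have h0 : m + x ≠ 0 := by omega
  rw [h.starDegree_head, if_neg h0, starDegree]
  simp only [starAdj_comm (m + x), h.starAdj_tail]
  rw [Finset.sum_ite_eq' (range m) 0 (fun _ => 1)]
  simp [hm]

lemma PairsBelow.sum_starDegree (h : PairsBelow L m) (k : ℕ) :
    ∑ i ∈ range (m + k), starDegree (m + k) L i = ∑ i ∈ range m, starDegree m L i + 2 * k := by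
  rw [Finset.sum_range_add]
  simp only [h.starDegree_tail]
  simp only [h.starDegree_head, Finset.sum_add_distrib]
  rw [Finset.sum_ite_eq' (range m) 0 (fun _ => k)]
  simp [h.1]
  ring

/-- The double sum splits into the head, the two mixed blocks, where only the centre sees the `k`
pendent vertices, and the tail, which spans no edges. -/
lemma PairsBelow.two_mul_generalSumConnectivity (h : PairsBelow L m) (α : ℝ) (k : ℕ) :
    2 * generalSumConnectivity α (starPlus (m + k) L) =
      ∑ i ∈ range m, ∑ j ∈ range m, (if StarAdj L i j then
        ((starDegree (m + k) L i : ℝ) + starDegree (m + k) L j) ^ α else 0) +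
      2 * (k * ((starDegree (m + k) L 0 : ℝ) + 1) ^ α) := by
  rw [two_mul_generalSumConnectivity_starPlus, Finset.sum_range_add]
  simp only [Finset.sum_range_add _ m k]
  simp only [h.starAdj_tail, starAdj_comm (m + _), h.starDegree_tail]
  have h0 : ∀ x, m + x ≠ 0 := fun x => by have := h.1; omega
  simp only [h0, if_false, Finset.sum_const_zero, add_zero, Finset.sum_add_distrib]
  have e1 : ∀ x : ℕ, ∑ j ∈ range m, (if j = 0 then
      ((1 : ℕ) + (starDegree (m + k) L j : ℝ)) ^ α else 0) =
      ((starDegree (m + k) L 0 : ℝ) + 1) ^ α := by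
    intro _
    rw [Finset.sum_ite_eq' (range m) 0 (fun j => ((1 : ℕ) + (starDegree (m + k) L j : ℝ)) ^ α)]
    simp [h.1, add_comm]
  have e2 : ∑ i ∈ range m, ∑ j ∈ range k, (if i = 0 then
      ((starDegree (m + k) L i : ℝ) + (1 : ℕ)) ^ α else 0) =
      k * ((starDegree (m + k) L 0 : ℝ) + 1) ^ α := by
    rw [Finset.sum_comm]
    simp only [Finset.sum_ite_eq' (range m) 0
      (fun j => ((starDegree (m + k) L j : ℝ) + (1 : ℕ)) ^ α)]
    simp [h.1]
  rw [e2, Finset.sum_congr rfl (fun x _ => e1 x)]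
  simp
  ring

lemma PairsBelow.isCyclicGraph (h : PairsBelow L m) {n : ℕ} (hn : m ≤ n) {c : ℕ}
    (hc : ∑ i ∈ range m, starDegree m L i + 2 = 2 * m + 2 * c) :
    IsCyclicGraph c (starPlus n L) := by
  obtain ⟨k, rfl⟩ := Nat.exists_eq_add_of_le hn
  refine starPlus_isCyclicGraph (by have := h.1; omega) _ ?_
  rw [h.sum_starDegree]
  omega

lemma graphS_isCyclicGraph {n : ℕ} (hn : 1 ≤ n) : IsCyclicGraph 0 (graphS n) :=
  PairsBelow.isCyclicGraph (m := 1) (by simp [PairsBelow]) hn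
    (by simp [starDegree, StarAdj, -Finset.sum_boole])

lemma graphSPlus_isCyclicGraph {n : ℕ} (hn : 3 ≤ n) : IsCyclicGraph 1 (graphSPlus n) :=
  PairsBelow.isCyclicGraph (m := 3) (by simp [PairsBelow]) hn
    (by simp [starDegree, StarAdj, Finset.sum_range_succ, -Finset.sum_boole])

lemma graphB1_isCyclicGraph {n : ℕ} (hn : 4 ≤ n) : IsCyclicGraph 2 (graphB1 n) :=
  PairsBelow.isCyclicGraph (m := 4) (by simp [PairsBelow]) hn
    (by simp [starDegree, StarAdj, Finset.sum_range_succ, -Finset.sum_boole])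

lemma graphG4_isCyclicGraph {n : ℕ} (hn : 5 ≤ n) : IsCyclicGraph 3 (graphG4 n) :=
  PairsBelow.isCyclicGraph (m := 5) (by simp [PairsBelow]) hn
    (by simp [starDegree, StarAdj, Finset.sum_range_succ, -Finset.sum_boole])

lemma graphG5_isCyclicGraph {n : ℕ} (hn : 5 ≤ n) : IsCyclicGraph 3 (graphG5 n) :=
  PairsBelow.isCyclicGraph (m := 5) (by simp [PairsBelow]) hn
    (by simp [starDegree, StarAdj, Finset.sum_range_succ, -Finset.sum_boole])

lemma graphH4_isCyclicGraph {n : ℕ} (hn : 6 ≤ n) : IsCyclicGraph 4 (graphH4 n) :=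
  PairsBelow.isCyclicGraph (m := 6) (by simp [PairsBelow]) hn
    (by simp [starDegree, StarAdj, Finset.sum_range_succ, -Finset.sum_boole])

lemma graphH5_isCyclicGraph {n : ℕ} (hn : 5 ≤ n) : IsCyclicGraph 4 (graphH5 n) :=
  PairsBelow.isCyclicGraph (m := 5) (by simp [PairsBelow]) hn
    (by simp [starDegree, StarAdj, Finset.sum_range_succ, -Finset.sum_boole])

lemma generalSumConnectivity_graphG4 (α : ℝ) (k : ℕ) :
    generalSumConnectivity α (graphG4 (5 + k)) = ((k : ℝ) + 8) ^ α + 3 * ((k : ℝ) + 6) ^ α +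
      3 * (6 : ℝ) ^ α + k * ((k : ℝ) + 5) ^ α := by
  have hL : PairsBelow [(1, 2), (1, 3), (1, 4)] 5 := by simp [PairsBelow]
  have h := hL.two_mul_generalSumConnectivity α k
  have d : starDegree 5 [(1, 2), (1, 3), (1, 4)] 0 = 4 ∧
      starDegree 5 [(1, 2), (1, 3), (1, 4)] 1 = 4 ∧
      starDegree 5 [(1, 2), (1, 3), (1, 4)] 2 = 2 ∧
      starDegree 5 [(1, 2), (1, 3), (1, 4)] 3 = 2 ∧
      starDegree 5 [(1, 2), (1, 3), (1, 4)] 4 = 2 := by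
    simp [starDegree, StarAdj, Finset.sum_range_succ, -Finset.sum_boole]
  obtain ⟨d0, d1, d2, d3, d4⟩ := d
  simp [hL.starDegree_head, d0, d1, d2, d3, d4, StarAdj, Finset.sum_range_succ,
    -Finset.sum_boole] at h
  norm_num at h
  rw [graphG4]
  ring_nf at h ⊢
  linarith

lemma generalSumConnectivity_graphG5 (α : ℝ) (k : ℕ) :
    generalSumConnectivity α (graphG5 (5 + k)) = 3 * ((k : ℝ) + 7) ^ α +
      3 * (6 : ℝ) ^ α + (k + 1) * ((k : ℝ) + 5) ^ α := by
  have hL : PairsBelow [(1, 2), (1, 3), (2, 3)] 5 := by simp [PairsBelow]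
  have h := hL.two_mul_generalSumConnectivity α k
  have d : starDegree 5 [(1, 2), (1, 3), (2, 3)] 0 = 4 ∧
      starDegree 5 [(1, 2), (1, 3), (2, 3)] 1 = 3 ∧
      starDegree 5 [(1, 2), (1, 3), (2, 3)] 2 = 3 ∧
      starDegree 5 [(1, 2), (1, 3), (2, 3)] 3 = 3 ∧
      starDegree 5 [(1, 2), (1, 3), (2, 3)] 4 = 1 := by
    simp [starDegree, StarAdj, Finset.sum_range_succ, -Finset.sum_boole]
  obtain ⟨d0, d1, d2, d3, d4⟩ := d
  simp [hL.starDegree_head, d0, d1, d2, d3, d4, StarAdj, Finset.sum_range_succ,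
    -Finset.sum_boole] at h
  norm_num at h
  rw [graphG5]
  ring_nf at h ⊢
  linarith

lemma generalSumConnectivity_graphH4 (α : ℝ) (k : ℕ) :
    generalSumConnectivity α (graphH4 (6 + k)) = ((k : ℝ) + 10) ^ α + 4 * ((k : ℝ) + 7) ^ α +
      4 * (7 : ℝ) ^ α + k * ((k : ℝ) + 6) ^ α := by
  have hL : PairsBelow [(1, 2), (1, 3), (1, 4), (1, 5)] 6 := by simp [PairsBelow]
  have h := hL.two_mul_generalSumConnectivity α k
  have d : starDegree 6 [(1, 2), (1, 3), (1, 4), (1, 5)] 0 = 5 ∧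
      starDegree 6 [(1, 2), (1, 3), (1, 4), (1, 5)] 1 = 5 ∧
      starDegree 6 [(1, 2), (1, 3), (1, 4), (1, 5)] 2 = 2 ∧
      starDegree 6 [(1, 2), (1, 3), (1, 4), (1, 5)] 3 = 2 ∧
      starDegree 6 [(1, 2), (1, 3), (1, 4), (1, 5)] 4 = 2 ∧
      starDegree 6 [(1, 2), (1, 3), (1, 4), (1, 5)] 5 = 2 := by
    simp [starDegree, StarAdj, Finset.sum_range_succ, -Finset.sum_boole]
  obtain ⟨d0, d1, d2, d3, d4, d5⟩ := d
  simp [hL.starDegree_head, d0, d1, d2, d3, d4, d5, StarAdj, Finset.sum_range_succ,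
    -Finset.sum_boole] at h
  norm_num at h
  rw [graphH4]
  ring_nf at h ⊢
  linarith

/-- Five labels would suffice, but a head of six vertices aligns `k` with the formula for `graphH4`.
-/
lemma generalSumConnectivity_graphH5 (α : ℝ) (k : ℕ) :
    generalSumConnectivity α (graphH5 (6 + k)) = ((k : ℝ) + 9) ^ α + 2 * ((k : ℝ) + 8) ^ α +
      ((k : ℝ) + 7) ^ α + 2 * (7 : ℝ) ^ α + 2 * (6 : ℝ) ^ α + (k + 1) * ((k : ℝ) + 6) ^ α := by
  have hL : PairsBelow [(1, 2), (1, 3), (2, 3), (1, 4)] 6 := by simp [PairsBelow]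
  have h := hL.two_mul_generalSumConnectivity α k
  have d : starDegree 6 [(1, 2), (1, 3), (2, 3), (1, 4)] 0 = 5 ∧
      starDegree 6 [(1, 2), (1, 3), (2, 3), (1, 4)] 1 = 4 ∧
      starDegree 6 [(1, 2), (1, 3), (2, 3), (1, 4)] 2 = 3 ∧
      starDegree 6 [(1, 2), (1, 3), (2, 3), (1, 4)] 3 = 3 ∧
      starDegree 6 [(1, 2), (1, 3), (2, 3), (1, 4)] 4 = 2 ∧
      starDegree 6 [(1, 2), (1, 3), (2, 3), (1, 4)] 5 = 1 := by
    simp [starDegree, StarAdj, Finset.sum_range_succ, -Finset.sum_boole]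
  obtain ⟨d0, d1, d2, d3, d4, d5⟩ := d
  simp [hL.starDegree_head, d0, d1, d2, d3, d4, d5, StarAdj, Finset.sum_range_succ,
    -Finset.sum_boole] at h
  norm_num at h
  rw [graphH5]
  ring_nf at h ⊢
  linarith

end StarPlus

/-! ### Finite differences of real powers. -/

section PowerInequalities

lemma exists_rpow_diff_eq (α : ℝ) {x : ℝ} (hx : 0 < x) :
    ∃ c, x < c ∧ c < x + 1 ∧ (x + 1) ^ α - x ^ α = α * c ^ (α - 1) := by
  have hd : ∀ y, 0 < y → HasDerivAt (fun y : ℝ => y ^ α) (α * y ^ (α - 1)) y := fun y hy =>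
    Real.hasDerivAt_rpow_const (Or.inl hy.ne')
  obtain ⟨c, hc, h⟩ := exists_hasDerivAt_eq_slope (fun y : ℝ => y ^ α)
    (fun y => α * y ^ (α - 1)) (show x < x + 1 by linarith)
    (fun y hy => (hd y (by linarith [hy.1])).continuousAt.continuousWithinAt)
    (fun y hy => hd y (by linarith [hy.1]))
  exact ⟨c, hc.1, hc.2, by simpa using h.symm⟩

/-- A third difference is a first difference of second differences; the mean value theorem trades
one order of differencing for a derivative. What remains is a second difference of `t ^ (α - 1)`,
whose sign is a matter of convexity or concavity. -/
lemma exists_rpow_third_diff_eq (α : ℝ) {x : ℝ} (hx : 0 < x) :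
    ∃ c, 0 < c ∧ (x + 3) ^ α - 3 * (x + 2) ^ α + 3 * (x + 1) ^ α - x ^ α =
      α * ((c + 2) ^ (α - 1) - 2 * (c + 1) ^ (α - 1) + c ^ (α - 1)) := by
  have hd : ∀ s : ℝ, 0 ≤ s → ∀ y, 0 < y →
      HasDerivAt (fun y : ℝ => (y + s) ^ α) (α * (y + s) ^ (α - 1)) y := by
    intro s hs y hy
    have h := (Real.hasDerivAt_rpow_const (x := y + s) (p := α)
      (Or.inl (by linarith : 0 < y + s).ne')).comp_add_const y s
    exact h
  have hd' : ∀ y, 0 < y → HasDerivAt (fun y : ℝ => (y + 2) ^ α - 2 * (y + 1) ^ α + (y + 0) ^ α)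
      (α * (y + 2) ^ (α - 1) - 2 * (α * (y + 1) ^ (α - 1)) + α * (y + 0) ^ (α - 1)) y :=
    fun y hy => ((hd 2 (by norm_num) y hy).sub ((hd 1 (by norm_num) y hy).const_mul 2)).add
      (hd 0 le_rfl y hy)
  obtain ⟨c, hc, h⟩ := exists_hasDerivAt_eq_slope
    (fun y : ℝ => (y + 2) ^ α - 2 * (y + 1) ^ α + (y + 0) ^ α)
    (fun y => α * (y + 2) ^ (α - 1) - 2 * (α * (y + 1) ^ (α - 1)) + α * (y + 0) ^ (α - 1))
    (show x < x + 1 by linarith)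
    (fun y hy => (hd' y (by linarith [hy.1])).continuousAt.continuousWithinAt)
    (fun y hy => hd' y (by linarith [hy.1]))
  refine ⟨c, by linarith [hc.1], ?_⟩
  simp only [add_zero, add_sub_cancel_left, div_one] at h
  have e1 : x + 1 + 2 = x + 3 := by ring
  have e2 : x + 1 + 1 = x + 2 := by ring
  rw [e1, e2] at h
  linarith

lemma rpow_third_diff_pos {α x : ℝ} (hα : 2 < α) (hx : 0 < x) :
    0 < (x + 3) ^ α - 3 * (x + 2) ^ α + 3 * (x + 1) ^ α - x ^ α := by
  obtain ⟨c, hc, h⟩ := exists_rpow_third_diff_eq α hx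
  rw [h]
  have := (strictConvexOn_rpow (p := α - 1) (by linarith)).2
    (Set.mem_Ici.2 hc.le) (Set.mem_Ici.2 (by linarith : (0 : ℝ) ≤ c + 2)) (by linarith)
    (by norm_num : (0 : ℝ) < 1 / 2) (by norm_num : (0 : ℝ) < 1 / 2) (by norm_num)
  simp only [smul_eq_mul] at this
  rw [show 1 / 2 * c + 1 / 2 * (c + 2) = c + 1 by ring] at this
  exact mul_pos (by linarith) (by linarith)

lemma rpow_third_diff_neg {α x : ℝ} (hα : 1 < α) (hα' : α < 2) (hx : 0 < x) :
    (x + 3) ^ α - 3 * (x + 2) ^ α + 3 * (x + 1) ^ α - x ^ α < 0 := by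
  obtain ⟨c, hc, h⟩ := exists_rpow_third_diff_eq α hx
  rw [h]
  have := (Real.strictConcaveOn_rpow (p := α - 1) (by linarith) (by linarith)).2
    (Set.mem_Ici.2 hc.le) (Set.mem_Ici.2 (by linarith : (0 : ℝ) ≤ c + 2)) (by linarith)
    (by norm_num : (0 : ℝ) < 1 / 2) (by norm_num : (0 : ℝ) < 1 / 2) (by norm_num)
  simp only [smul_eq_mul] at this
  rw [show 1 / 2 * c + 1 / 2 * (c + 2) = c + 1 by ring] at this
  exact mul_neg_of_pos_of_neg (by linarith) (by linarith)

/-- With `D i = (x + i + 1) ^ α - (x + i) ^ α` and `δ = 7 ^ α - 6 ^ α`, the expression is `D 3 - 2 *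
D 1 + D 0 + 2 * δ`. For `α > 2` it exceeds the positive third difference `D 2 - 2 * D 1 + D 0`,
since `D 3 ≥ D 2`. For `α ≤ 2`, `D 3 ≥ D 1` and `D 1 ≤ D 0 + δ`, which leaves at least `δ`. -/
lemma rpow_tetracyclic_pos {α x : ℝ} (hα : 1 ≤ α) (hx : 0 < x) :
    0 < (x + 4) ^ α - (x + 3) ^ α - 2 * (x + 2) ^ α + 3 * (x + 1) ^ α - x ^ α +
      2 * (7 : ℝ) ^ α - 2 * (6 : ℝ) ^ α := by
  obtain ⟨c₀, h0, h0', e0⟩ := exists_rpow_diff_eq α hx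
  obtain ⟨c₁, h1, h1', e1⟩ := exists_rpow_diff_eq α (show 0 < x + 1 by linarith)
  obtain ⟨c₂, h2, h2', e2⟩ := exists_rpow_diff_eq α (show 0 < x + 2 by linarith)
  obtain ⟨c₃, h3, h3', e3⟩ := exists_rpow_diff_eq α (show 0 < x + 3 by linarith)
  obtain ⟨c, h, h', e⟩ := exists_rpow_diff_eq α (show (0 : ℝ) < 6 by norm_num)
  rw [show x + 1 + 1 = x + 2 by ring] at e1
  rw [show x + 2 + 1 = x + 3 by ring] at e2
  rw [show x + 3 + 1 = x + 4 by ring] at e3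
  rw [show (6 : ℝ) + 1 = 7 by norm_num] at e
  have hα0 : 0 < α := by linarith
  have hp : 0 ≤ α - 1 := by linarith
  have hcpos : 0 < α * c ^ (α - 1) := mul_pos hα0 (Real.rpow_pos_of_pos (by linarith) _)
  rcases lt_or_ge 2 α with hα2 | hα2
  · have ht := rpow_third_diff_pos hα2 hx
    have h32 : α * c₂ ^ (α - 1) ≤ α * c₃ ^ (α - 1) :=
      mul_le_mul_of_nonneg_left (Real.rpow_le_rpow (by linarith) (by linarith) hp) hα0.le
    linarith
  · have h31 : α * c₁ ^ (α - 1) ≤ α * c₃ ^ (α - 1) :=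
      mul_le_mul_of_nonneg_left (Real.rpow_le_rpow (by linarith) (by linarith) hp) hα0.le
    -- As `c₁ < x + 2` and `c₀ + c > x + 6`, monotonicity gives the first bound; the second is
    -- subadditivity of `t ^ (α - 1)`, whose exponent lies in `[0, 1]`.
    have h10 : c₁ ^ (α - 1) ≤ c₀ ^ (α - 1) + c ^ (α - 1) :=
      calc c₁ ^ (α - 1) ≤ (c₀ + c) ^ (α - 1) :=
            Real.rpow_le_rpow (by linarith) (by linarith) hp
        _ ≤ _ := Real.rpow_add_le_add_rpow (by linarith) (by linarith) hp (by linarith)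
    have h10' := mul_le_mul_of_nonneg_left h10 hα0.le
    rw [mul_add] at h10'
    linarith

end PowerInequalities

/-! ### Comparing the two tricyclic and the two tetracyclic candidates. -/

section Comparison

lemma generalSumConnectivity_graphG4_sub_graphG5 (α : ℝ) {n : ℕ} (hn : 5 ≤ n) :
    generalSumConnectivity α (graphG4 n) - generalSumConnectivity α (graphG5 n) =
      ((n : ℝ) + 3) ^ α - 3 * ((n : ℝ) + 2) ^ α + 3 * ((n : ℝ) + 1) ^ α - (n : ℝ) ^ α := by
  obtain ⟨k, rfl⟩ := Nat.exists_eq_add_of_le hn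
  rw [generalSumConnectivity_graphG4, generalSumConnectivity_graphG5]
  push_cast
  ring_nf

lemma generalSumConnectivity_graphH5_lt_graphH4 {α : ℝ} (hα : 1 ≤ α) {n : ℕ} (hn : 6 ≤ n) :
    generalSumConnectivity α (graphH5 n) < generalSumConnectivity α (graphH4 n) := by
  obtain ⟨k, rfl⟩ := Nat.exists_eq_add_of_le hn
  rw [generalSumConnectivity_graphH4, generalSumConnectivity_graphH5]
  have h := rpow_tetracyclic_pos hα (show (0 : ℝ) < 6 + k by positivity)
  ring_nf at h ⊢
  linarith

end Comparison

/-! ### From candidates to maximisers. -/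

section Maximisers
variable {V W : Type*} [Fintype V] [Fintype W] {α : ℝ} {c n : ℕ}

lemma IsChiMaximiser.le_of_card_eq {M : SimpleGraph V} (hM : IsChiMaximiser α c M)
    {H : SimpleGraph W} (hH : IsCyclicGraph c H) (hVW : Fintype.card V = Fintype.card W) :
    generalSumConnectivity α H ≤ generalSumConnectivity α M := by
  have e := SimpleGraph.Iso.comap (Fintype.equivOfCardEq hVW) H
  rw [← generalSumConnectivity_congr α e]
  exact hM.2 _ (hH.congr e.symm)

lemma exists_isChiMaximiser (α : ℝ) {H : SimpleGraph V} (hH : IsCyclicGraph c H) :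
    ∃ M : SimpleGraph V, IsChiMaximiser α c M := by
  have : Nonempty {G : SimpleGraph V // IsCyclicGraph c G} := ⟨⟨H, hH⟩⟩
  obtain ⟨M, hM⟩ := Finite.exists_max
    (fun G : {G : SimpleGraph V // IsCyclicGraph c G} => generalSumConnectivity α G.1)
  exact ⟨M.1, M.2, fun G' hG' => hM ⟨G', hG'⟩⟩

/-- A maximiser exists because there are finitely many graphs on `V`, so it suffices to bound the
index of maximisers, which are classified, rather than of all competitors. -/
lemma isChiMaximiser_of_iso {H : SimpleGraph W} (hH : IsCyclicGraph c H)
    (hle : ∀ M : SimpleGraph V, IsChiMaximiser α c M →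
      generalSumConnectivity α M ≤ generalSumConnectivity α H)
    {G : SimpleGraph V} (hG : Nonempty (G ≃g H)) : IsChiMaximiser α c G := by
  obtain ⟨e⟩ := hG
  have hcG := hH.congr e.symm
  obtain ⟨M, hM⟩ := exists_isChiMaximiser α hcG
  refine ⟨hcG, fun G' hG' => ?_⟩
  rw [generalSumConnectivity_congr α e]
  exact (hM.2 G' hG').trans (hle M hM)

lemma isChiMaximiser_iff_of_unique {H : SimpleGraph W} (hH : IsCyclicGraph c H)
    (huniq : ∀ M : SimpleGraph V, IsChiMaximiser α c M → Nonempty (M ≃g H)) (G : SimpleGraph V) :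
    IsChiMaximiser α c G ↔ Nonempty (G ≃g H) :=
  ⟨huniq G, isChiMaximiser_of_iso hH fun M hM =>
    (generalSumConnectivity_congr α (huniq M hM).some).le⟩

lemma IsChiMaximiser.classify (hα : 1 ≤ α) (hn : Fintype.card V = n) {G : SimpleGraph V}
    (hG : IsChiMaximiser α c G) :
    (c = 0 → Nonempty (G ≃g graphS n)) ∧ (c = 1 → Nonempty (G ≃g graphSPlus n)) ∧
    (c = 2 → Nonempty (G ≃g graphB1 n)) ∧
    (c = 3 → Nonempty (G ≃g graphG4 n) ∨ Nonempty (G ≃g graphG5 n)) ∧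
    (c = 4 → (Nonempty (G ≃g graphH4 n) ∧ 6 ≤ n) ∨ Nonempty (G ≃g graphH5 n)) := by
  obtain ⟨z, hz⟩ := hG.exists_dominating hα
  exact (hG.isNestedGraph hα).classify hn hz (adjCount_erase_dominating hG.1 hz)

end Maximisers

end

/-! ### The main theorem. -/

theorem theorem6 {V : Type*} [Fintype V] (n : ℕ) (hn : Fintype.card V = n)
    (α : ℝ) (hα : 1 ≤ α) :
    -- trees
    (1 ≤ n → ∀ G : SimpleGraph V,
      IsChiMaximiser α 0 G ↔ Nonempty (G ≃g graphS n)) ∧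
    -- unicyclic graphs
    (3 ≤ n → ∀ G : SimpleGraph V,
      IsChiMaximiser α 1 G ↔ Nonempty (G ≃g graphSPlus n)) ∧
    -- bicyclic graphs
    (4 ≤ n → ∀ G : SimpleGraph V,
      IsChiMaximiser α 2 G ↔ Nonempty (G ≃g graphB1 n)) ∧
    -- tricyclic graphs
    (5 ≤ n →
      (IsChiMaximiser α 3 (graphG4 n) ∨ IsChiMaximiser α 3 (graphG5 n)) ∧
      (1 < α → α < 2 →
        generalSumConnectivity α (graphG4 n) < generalSumConnectivity α (graphG5 n) ∧
        ∀ G : SimpleGraph V, IsChiMaximiser α 3 G ↔ Nonempty (G ≃g graphG5 n)) ∧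
      (2 < α →
        generalSumConnectivity α (graphG4 n) > generalSumConnectivity α (graphG5 n) ∧
        ∀ G : SimpleGraph V, IsChiMaximiser α 3 G ↔ Nonempty (G ≃g graphG4 n)) ∧
      (α = 1 ∨ α = 2 →
        generalSumConnectivity α (graphG4 n) = generalSumConnectivity α (graphG5 n) ∧
        ∀ G : SimpleGraph V, IsChiMaximiser α 3 G ↔
          Nonempty (G ≃g graphG4 n) ∨ Nonempty (G ≃g graphG5 n))) ∧
    -- tetracyclic graphs
    (6 ≤ n → ∀ G : SimpleGraph V,
      IsChiMaximiser α 4 G ↔ Nonempty (G ≃g graphH4 n)) ∧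
    (n = 5 → ∀ G : SimpleGraph V,
      IsChiMaximiser α 4 G ↔ Nonempty (G ≃g graphH5 n)) := by
  have hcard : Fintype.card V = Fintype.card (Fin n) := by simpa using hn
  refine ⟨fun h => isChiMaximiser_iff_of_unique (graphS_isCyclicGraph h) fun M hM =>
      (hM.classify hα hn).1 rfl,
    fun h => isChiMaximiser_iff_of_unique (graphSPlus_isCyclicGraph h) fun M hM =>
      (hM.classify hα hn).2.1 rfl,
    fun h => isChiMaximiser_iff_of_unique (graphB1_isCyclicGraph h) fun M hM =>
      (hM.classify hα hn).2.2.1 rfl, fun h => ?_, fun h => ?_, fun h => ?_⟩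
  · have hc4 := graphG4_isCyclicGraph h
    have hc5 := graphG5_isCyclicGraph h
    have hdiff := generalSumConnectivity_graphG4_sub_graphG5 α h
    have hpos : (0 : ℝ) < n := by
      have : 0 < n := by omega
      exact_mod_cast this
    refine ⟨?_, fun h1 h2 => ?_, fun h2 => ?_, fun h12 => ?_⟩
    · rcases le_total (generalSumConnectivity α (graphG4 n))
        (generalSumConnectivity α (graphG5 n)) with hle | hle
      · refine Or.inr (isChiMaximiser_of_iso hc5 (fun M hM => ?_) ⟨SimpleGraph.Iso.refl⟩)
        rcases (hM.classify hα (Fintype.card_fin n)).2.2.2.1 rfl with ⟨⟨e⟩⟩ | ⟨⟨e⟩⟩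
        · rwa [generalSumConnectivity_congr α e]
        · rw [generalSumConnectivity_congr α e]
      · refine Or.inl (isChiMaximiser_of_iso hc4 (fun M hM => ?_) ⟨SimpleGraph.Iso.refl⟩)
        rcases (hM.classify hα (Fintype.card_fin n)).2.2.2.1 rfl with ⟨⟨e⟩⟩ | ⟨⟨e⟩⟩
        · rw [generalSumConnectivity_congr α e]
        · rwa [generalSumConnectivity_congr α e]
    · have hlt : generalSumConnectivity α (graphG4 n) < generalSumConnectivity α (graphG5 n) := by
        linarith [rpow_third_diff_neg h1 h2 hpos]
      refine ⟨hlt, isChiMaximiser_iff_of_unique hc5 fun M hM => ?_⟩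
      refine ((hM.classify hα hn).2.2.2.1 rfl).resolve_left ?_
      rintro ⟨e⟩
      have := hM.le_of_card_eq hc5 hcard
      rw [generalSumConnectivity_congr α e] at this
      linarith
    · have hlt : generalSumConnectivity α (graphG4 n) > generalSumConnectivity α (graphG5 n) := by
        linarith [rpow_third_diff_pos h2 hpos]
      refine ⟨hlt, isChiMaximiser_iff_of_unique hc4 fun M hM => ?_⟩
      refine ((hM.classify hα hn).2.2.2.1 rfl).resolve_right ?_
      rintro ⟨e⟩
      have := hM.le_of_card_eq hc4 hcard
      rw [generalSumConnectivity_congr α e] at this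
      linarith
    · have heq : generalSumConnectivity α (graphG4 n) = generalSumConnectivity α (graphG5 n) := by
        rw [← sub_eq_zero, hdiff]
        -- A third difference annihilates polynomials of degree at most two.
        rcases h12 with rfl | rfl
        · simp only [Real.rpow_one]; ring
        · simp only [Real.rpow_two]; ring
      have hle : ∀ M : SimpleGraph V, IsChiMaximiser α 3 M →
          generalSumConnectivity α M = generalSumConnectivity α (graphG4 n) := by
        intro M hM
        rcases (hM.classify hα hn).2.2.2.1 rfl with ⟨⟨e⟩⟩ | ⟨⟨e⟩⟩
        · exact generalSumConnectivity_congr α e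
        · rw [heq]; exact generalSumConnectivity_congr α e
      refine ⟨heq, fun G => ⟨fun hG => (hG.classify hα hn).2.2.2.1 rfl, ?_⟩⟩
      rintro (hG | hG)
      · exact isChiMaximiser_of_iso hc4 (fun M hM => (hle M hM).le) hG
      · exact isChiMaximiser_of_iso hc5 (fun M hM => ((hle M hM).trans heq).le) hG
  · refine isChiMaximiser_iff_of_unique (graphH4_isCyclicGraph h) fun M hM => ?_
    refine (((hM.classify hα hn).2.2.2.2 rfl).resolve_right ?_).1
    rintro ⟨e⟩
    have h1 := hM.le_of_card_eq (graphH4_isCyclicGraph h) hcard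
    rw [generalSumConnectivity_congr α e] at h1
    linarith [generalSumConnectivity_graphH5_lt_graphH4 hα h]
  · refine isChiMaximiser_iff_of_unique (graphH5_isCyclicGraph h.ge) fun M hM => ?_
    -- The bare star on four leaves needs six vertices in all, so it is excluded by size and no
    -- comparison of indices is needed.
    refine ((hM.classify hα hn).2.2.2.2 rfl).resolve_left ?_
    rintro ⟨_, h6⟩
    omega
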